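/- Let $G$ be a locally compact Hausdorff topological group. A $G$-flow is a jointly continuous action of $G$ on a compact Hausdorff space, and an action of $G$ on $X$ is free if for every $x \in X$ the orbit map $G \to X$, $g \mapsto g \cdot x$, is injective. Then $G$ admits a non-empty free $G$-flow. Concretely, let $\mathrm{RUCB}(G)$ be the Riesz space (with pointwise operations, unit the constant function $\mathbf 1$, and the sup norm) of all bounded functions $f \colon G \to \mathbb R$ that are right uniformly continuous: for every $\varepsilon > 0$ there is a neighbourhood $V$ of $1_G$ such that $|f(vx) - f(x)| < \varepsilon$ for all $v \in V$, $x \in G$. Let the Samuel compactification $$\mathrm{Sam}(G) = \{\varphi \in \mathrm{RUCB}(G)^* : \varphi(a \vee b) = \varphi(a) \vee \varphi(b) \text{ for all } a, b \in \mathrm{RUCB}(G), \text{ and } \varphi(\mathbf 1) = 1\}$$ be its spectrum, with the weak$^*$ topology and the action $(g \cdot \varphi)(f) = \varphi(x \mapsto f(gx))$, which extends left translation on $G$. Then $\mathrm{Sam}(G)$ is non-empty and is a free $G$-flow. -/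

import Mathlib

open scoped BoundedContinuousFunction

universe u

noncomputable section

/-- A `G`-flow: a (jointly) continuous action of `G` on a compact Hausdorff space. -/
structure IsFlow (G X : Type*) [Group G] [TopologicalSpace G] [TopologicalSpace X]
    [MulAction G X] : Prop where
  compactSpace : CompactSpace X
  t2Space : T2Space X
  continuousSMul : ContinuousSMul G X

/-- A point is free if its orbit map `g ↦ g • x` is injective. -/
def IsFreePoint (G : Type*) {X : Type*} [Group G] [MulAction G X] (x : X) : Prop :=
  Function.Injective fun g : G => g • x

/-- An action is free if all points are free. -/
def IsFreeAction (G X : Type*) [Group G] [MulAction G X] : Prop :=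
  ∀ x : X, IsFreePoint G x

section Samuel

variable (G : Type u) [Group G] [TopologicalSpace G] [IsTopologicalGroup G]

/-- The space of bounded real functions on `G` that are uniformly continuous for the right
uniformity, which is generated by the sets `{(x, y) | y * x⁻¹ ∈ V}`, `V` a neighbourhood of `1`.
It carries the sup norm and the pointwise operations. -/
def RUCB : Submodule ℝ (G →ᵇ ℝ) where
  carrier := {f | @UniformContinuous G ℝ (IsTopologicalGroup.rightUniformSpace G) _ f}
  zero_mem' := by
    let _ := IsTopologicalGroup.rightUniformSpace G
    exact (uniformContinuous_const : UniformContinuous fun _ : G => (0 : ℝ))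
  add_mem' := by
    intro a b ha hb
    let _ := IsTopologicalGroup.rightUniformSpace G
    exact UniformContinuous.add (f := a) (g := b) ha hb
  smul_mem' := by
    intro c a ha
    let _ := IsTopologicalGroup.rightUniformSpace G
    exact UniformContinuous.const_smul (f := a) ha c

variable {G}

theorem RUCB.sup_mem {a b : G →ᵇ ℝ} (ha : a ∈ RUCB G) (hb : b ∈ RUCB G) : a ⊔ b ∈ RUCB G := by
  let _ := IsTopologicalGroup.rightUniformSpace G
  exact lipschitzWith_max.uniformContinuous.comp (UniformContinuous.prodMk (f₁ := a) (f₂ := b) ha hb)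

theorem RUCB.inf_mem {a b : G →ᵇ ℝ} (ha : a ∈ RUCB G) (hb : b ∈ RUCB G) : a ⊓ b ∈ RUCB G := by
  let _ := IsTopologicalGroup.rightUniformSpace G
  exact lipschitzWith_min.uniformContinuous.comp (UniformContinuous.prodMk (f₁ := a) (f₂ := b) ha hb)

/-- The pointwise maximum and minimum make `RUCB G` a Riesz space. -/
instance RUCB.instLattice : Lattice (RUCB G) :=
  Subtype.lattice (P := fun f => f ∈ RUCB G) (fun _ _ ha hb => RUCB.sup_mem ha hb)
    (fun _ _ ha hb => RUCB.inf_mem ha hb)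

/-- The unit of the Riesz space: the constant function `1`. -/
instance RUCB.instOne : One (RUCB G) :=
  ⟨⟨1, by
    let _ := IsTopologicalGroup.rightUniformSpace G
    exact (uniformContinuous_const : UniformContinuous fun _ : G => (1 : ℝ))⟩⟩

theorem RUCB.comp_mulLeft_mem (g : G) {f : G →ᵇ ℝ} (hf : f ∈ RUCB G) :
    f.compContinuous (ContinuousMap.mulLeft g) ∈ RUCB G := by
  let _ := IsTopologicalGroup.rightUniformSpace G
  have hg : UniformContinuous fun x : G => g * x := by
    rw [UniformContinuous, uniformity_eq_comap_nhds_one', Filter.tendsto_comap_iff]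
    have h : Filter.Tendsto (fun x : G => g * x * g⁻¹) (nhds 1) (nhds 1) := by
      have : Continuous fun x : G => g * x * g⁻¹ := by fun_prop
      simpa using this.tendsto 1
    refine (h.comp Filter.tendsto_comap).congr fun p => ?_
    simp [mul_assoc]
  exact UniformContinuous.comp (g := f) hf hg

/-- The translation `f ↦ f (g * ·)` on `RUCB G`. -/
def RUCB.translate (g : G) : RUCB G →L[ℝ] RUCB G where
  toFun f := ⟨f.1.compContinuous (ContinuousMap.mulLeft g), RUCB.comp_mulLeft_mem g f.2⟩
  map_add' _ _ := rfl
  map_smul' _ _ := rfl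
  cont := ((BoundedContinuousFunction.continuous_compContinuous _).comp
    continuous_subtype_val).subtype_mk _

variable (G)

/-- The Samuel compactification of `G`: the spectrum of the Riesz space `RUCB G`, that is, the set
of unital lattice homomorphisms in its dual, with the weak-* topology. -/
def Sam : Type u :=
  {φ : WeakDual ℝ (RUCB G) // (∀ a b : RUCB G, φ (a ⊔ b) = φ a ⊔ φ b) ∧ φ 1 = 1}

variable {G}

instance Sam.instTopologicalSpace : TopologicalSpace (Sam G) :=
  inferInstanceAs (TopologicalSpace
    {φ : WeakDual ℝ (RUCB G) // (∀ a b : RUCB G, φ (a ⊔ b) = φ a ⊔ φ b) ∧ φ 1 = 1})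

/-- The action of `G` on its Samuel compactification, `(g • φ) f = φ (f (g * ·))`. It extends
left translation: it sends the evaluation at `x` to the evaluation at `g * x`. -/
instance Sam.instMulAction : MulAction G (Sam G) where
  smul g φ := ⟨ContinuousLinearMap.comp (φ.1 : RUCB G →L[ℝ] ℝ) (RUCB.translate g),
    fun a b => φ.2.1 (RUCB.translate g a) (RUCB.translate g b), φ.2.2⟩
  one_smul φ := Subtype.ext <| ContinuousLinearMap.ext fun f =>
    congrArg φ.1 (Subtype.ext (BoundedContinuousFunction.ext fun x => congrArg f.1 (one_mul x)))
  mul_smul g h φ := Subtype.ext <| ContinuousLinearMap.ext fun f =>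
    congrArg φ.1 (Subtype.ext (BoundedContinuousFunction.ext fun x =>
      congrArg f.1 (mul_assoc g h x)))

end Samuel

end

open Filter Topology Pointwise

section Discrete

/-! For `g ≠ 1` it suffices to find finitely many `f i` in `RUCB G` such that at each `y` some drop
`f i y - f i (g * y)` is at least `1`. A fixed point `φ` of `g` kills the positive parts of all
these drops, yet their sum dominates `1`.

To get the `f i`, take a bump `h` equal to `1` on a compact neighbourhood `U` of `1` and to `0` on
`gU`, and spread it over a set `M` by taking suprema of right translates. If `M` is sparse enough,
the bumps do not interfere. `exists_cover_discrete` shows that finitely many sparse sets reach every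
`y`. -/

/-- Every set contains a maximal subset whose distinct points are related by `r`. -/
theorem exists_maximal_pairwise {α : Type*} {r : α → α → Prop} (hr : ∀ a b, r a b → r b a)
    (S : Set α) :
    ∃ M ⊆ S, M.Pairwise r ∧ ∀ y ∈ S, y ∈ M ∨ ∃ a ∈ M, ¬ r y a := by
  obtain ⟨M, hM⟩ := zorn_subset {M : Set α | M ⊆ S ∧ M.Pairwise r} (by
    intro c hc hchain
    refine ⟨⋃₀ c, ⟨Set.sUnion_subset fun s hs => (hc hs).1, ?_⟩, fun s hs =>
      Set.subset_sUnion_of_mem hs⟩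
    exact (Set.pairwise_sUnion hchain.directedOn).2 fun s hs => (hc hs).2)
  refine ⟨M, hM.prop.1, hM.prop.2, fun y hy => ?_⟩
  by_contra! hcon
  refine hcon.1 (hM.le_of_ge (y := insert y M) ⟨Set.insert_subset hy hM.prop.1, ?_⟩
    (Set.subset_insert y M) (Set.mem_insert y M))
  exact hM.prop.2.insert fun b hb _ => ⟨hcon.2 b hb, hr _ _ (hcon.2 b hb)⟩

/-- For `U` a neighbourhood of `1` and `K` compact, the group is covered by finitely many sets
`U * M` with `M` being `K`-discrete. -/
theorem exists_cover_discrete {G : Type*} [Group G] [TopologicalSpace G] [IsTopologicalGroup G]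
    {U K : Set G} (hU : U ∈ 𝓝 (1 : G)) (hK : IsCompact K) :
    ∃ (n : ℕ) (M : ℕ → Set G), (∀ i, (M i).Pairwise fun a b => a * b⁻¹ ∉ K) ∧
      ∀ y, ∃ i < n, ∃ a ∈ M i, y * a⁻¹ ∈ U := by
  -- Symmetry is needed by `exists_maximal_pairwise`. Adding `1` makes each point close to itself,
  -- and costs nothing since discreteness tests distinct points only.
  set L : Set G := insert 1 (K ∪ K⁻¹) with hL
  have hLc : IsCompact L := (hK.union hK.inv).insert 1
  have hLinv : ∀ x ∈ L, x⁻¹ ∈ L := by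
    rintro x (rfl | hx | hx)
    · simp [hL]
    · exact Or.inr (Or.inr (by simpa using hx))
    · exact Or.inr (Or.inl hx)
  have hmax := exists_maximal_pairwise (r := fun a b : G => a * b⁻¹ ∉ L)
    (fun a b h h' => h (by simpa using hLinv _ h'))
  choose D hDS hDL hDmax using hmax
  -- `V * V⁻¹ ⊆ U`, and finitely many `V * k` cover `L`; their number bounds the rounds of the
  -- greedy removal `S`.
  obtain ⟨V, hV, hVU⟩ := exists_nhds_split_inv hU
  obtain ⟨t, -, ht⟩ := hLc.elim_nhds_subcover (fun k => (fun x => x * k⁻¹) ⁻¹' V) (fun k _ =>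
    (continuous_mul_const k⁻¹).continuousAt.preimage_mem_nhds (by simpa using hV))
  let S : ℕ → Set G := fun n =>
    n.rec Set.univ fun _ T => T \ {y | ∃ a ∈ D T, y * a⁻¹ ∈ U}
  have hS : ∀ n, S (n + 1) = S n \ {y | ∃ a ∈ D (S n), y * a⁻¹ ∈ U} := fun n => rfl
  have hSanti : Antitone S := antitone_nat_of_succ_le fun n => by
    rw [hS]; exact Set.sdiff_subset
  refine ⟨t.card + 1, fun i => D (S i), fun i => (hDL (S i)).imp fun a b h h' =>
    h (Or.inr (Or.inl h')), fun y => ?_⟩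
  by_contra! hcon
  have hy : ∀ i ≤ t.card + 1, y ∈ S i := by
    intro i
    induction i with
    | zero => exact fun _ => Set.mem_univ y
    | succ i ih =>
      intro hi
      rw [hS]
      exact ⟨ih (by omega), fun ⟨a, ha, h⟩ => hcon i (by omega) a ha h⟩
  have hm : ∀ i ≤ t.card + 1, ∃ a ∈ D (S i), a * y⁻¹ ∈ L := by
    intro i hi
    rcases hDmax (S i) y (hy i hi) with h | ⟨a, ha, h⟩
    · exact ⟨y, h, by simp [hL]⟩
    · exact ⟨a, ha, by simpa using hLinv _ (not_not.1 h)⟩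
  choose! m hmD hmL using hm
  have hk : ∀ i ≤ t.card + 1, ∃ k ∈ t, m i * y⁻¹ * k⁻¹ ∈ V := fun i hi => by
    simpa using ht (hmL i hi)
  choose! k hkt hkV using hk
  have hle : ∀ i ∈ Finset.range (t.card + 1), i ≤ t.card + 1 := fun i hi =>
    (Finset.mem_range.1 hi).le
  obtain ⟨i, hi, j, hj, hij, hkij⟩ := Finset.exists_ne_map_eq_of_card_lt_of_maps_to
    (s := Finset.range (t.card + 1)) (t := t) (by simp) (fun i hi => hkt i (hle i hi))
  -- A shared `k` puts `m j * (m i)⁻¹` in `V * V⁻¹ ⊆ U`, but `m j` survived the removal of `U * D (S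
  -- i)`.
  have key : ∀ i j, i ≤ t.card + 1 → j ≤ t.card + 1 → i < j → k i = k j → False := by
    intro i j hi hj hlt hkk
    have h1 := hSanti (Nat.succ_le_of_lt hlt) (hDS _ (hmD j hj))
    rw [Nat.succ_eq_add_one, hS] at h1
    refine h1.2 ⟨m i, hmD i hi, ?_⟩
    have h2 := hVU _ (hkV j hj) _ (hkV i hi)
    rw [hkk] at h2
    simpa [div_eq_mul_inv, mul_assoc] using h2
  rcases lt_or_gt_of_ne hij with h | h
  · exact key i j (hle i hi) (hle j hj) h hkij
  · exact key j i (hle j hj) (hle i hi) h hkij.symm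

end Discrete

section Samuel

variable {G : Type u} [Group G] [TopologicalSpace G] [IsTopologicalGroup G]

theorem uniformContinuous_right_iff {f : G → ℝ} :
    @UniformContinuous G ℝ (IsTopologicalGroup.rightUniformSpace G) _ f ↔
      ∀ ε > 0, ∀ᶠ v in 𝓝 (1 : G), ∀ x, |f (v * x) - f x| < ε := by
  let _ := IsTopologicalGroup.rightUniformSpace G
  have hb : (uniformity G).HasBasis (fun s : Set G => s ∈ 𝓝 (1 : G))
      fun s => (fun p : G × G => p.2 * p.1⁻¹) ⁻¹' s :=
    (𝓝 (1 : G)).basis_sets.comap _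
  rw [hb.uniformContinuous_iff Metric.uniformity_basis_dist]
  refine forall₂_congr fun ε _ => ⟨?_, fun h => ⟨_, h, fun x y hxy => ?_⟩⟩
  · rintro ⟨s, hs, h⟩
    filter_upwards [hs] with v hv x
    have : dist (f x) (f (v * x)) < ε := h x (v * x) (by simpa using hv)
    rwa [dist_comm, Real.dist_eq] at this
  · have : |f (y * x⁻¹ * x) - f x| < ε := hxy x
    change dist (f x) (f y) < ε
    rw [dist_comm, Real.dist_eq]
    simpa using this

namespace RUCB

@[simp]
theorem translate_apply (g : G) (f : RUCB G) (x : G) : (translate g f).1 x = f.1 (g * x) := rfl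

theorem mem_iff {f : G →ᵇ ℝ} :
    f ∈ RUCB G ↔ ∀ ε > 0, ∀ᶠ v in 𝓝 (1 : G), ∀ x, |f (v * x) - f x| < ε :=
  uniformContinuous_right_iff

/-- Translation is continuous in the group variable for the sup norm. -/
theorem continuous_translate (f : RUCB G) : Continuous fun g : G => translate g f := by
  rw [continuous_iff_continuousAt]
  intro g
  rw [ContinuousAt, Metric.tendsto_nhds]
  intro ε hε
  have h := mem_iff.1 f.2 (ε / 2) (half_pos hε)
  have ht : Tendsto (fun g' : G => g' * g⁻¹) (𝓝 g) (𝓝 1) := by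
    have : Continuous fun g' : G => g' * g⁻¹ := by fun_prop
    simpa using this.tendsto g
  filter_upwards [ht.eventually h] with g' hg'
  refine lt_of_le_of_lt ?_ (half_lt_self hε)
  refine (BoundedContinuousFunction.dist_le (half_pos hε).le).2 fun x => ?_
  have := hg' (g * x)
  rw [Real.dist_eq, translate_apply, translate_apply]
  simpa [mul_assoc] using this.le

/-- The supremum of the right translates of a uniformly continuous function by the inverses of the
elements of `M`. -/
theorem exists_iSup_translates {h : G → ℝ} (h01 : ∀ x, h x ∈ Set.Icc (0 : ℝ) 1)
    (hh : ∀ ε > 0, ∀ᶠ v in 𝓝 (1 : G), ∀ x, |h (v * x) - h x| < ε) (M : Set G) :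
    ∃ f : RUCB G, ∀ y, f.1 y = ⨆ a : M, h (y * (a : G)⁻¹) := by
  set F : G → ℝ := fun y => ⨆ a : M, h (y * (a : G)⁻¹) with hF
  have hbdd : ∀ y, BddAbove (Set.range fun a : M => h (y * (a : G)⁻¹)) := fun y =>
    ⟨1, by rintro _ ⟨a, rfl⟩; exact (h01 _).2⟩
  have hle : ∀ ε > 0, ∀ y z, (∀ a : G, h (y * a) ≤ h (z * a) + ε) → F y ≤ F z + ε := by
    intro ε hε y z hyz
    -- Covers empty `M`, where the supremum is `0` by convention.
    have h0 : 0 ≤ F z := Real.iSup_nonneg fun a => (h01 _).1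
    exact Real.iSup_le (fun a => (hyz _).trans (by gcongr; exact le_ciSup (hbdd z) a))
      (by positivity)
  have hFu : ∀ ε > 0, ∀ᶠ v in 𝓝 (1 : G), ∀ x, |F (v * x) - F x| < ε := by
    intro ε hε
    -- Since `v` acts on the left, one modulus serves all right translates of `h`.
    filter_upwards [hh (ε / 2) (half_pos hε)] with v hv x
    refine lt_of_le_of_lt (abs_sub_le_iff.2 ⟨?_, ?_⟩) (half_lt_self hε)
    · rw [sub_le_iff_le_add']
      refine hle _ (half_pos hε) _ _ fun a => ?_
      have := (abs_lt.1 (hv (x * a))).2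
      rw [mul_assoc]; linarith
    · rw [sub_le_iff_le_add']
      refine hle _ (half_pos hε) _ _ fun a => ?_
      have := (abs_lt.1 (hv (x * a))).1
      rw [mul_assoc]; linarith
  have hFu' := uniformContinuous_right_iff.2 hFu
  have hFc : Continuous F := by
    let _ := IsTopologicalGroup.rightUniformSpace G
    exact hFu'.continuous
  refine ⟨⟨BoundedContinuousFunction.ofNormedAddCommGroup F hFc 1 fun y => ?_, hFu'⟩,
    fun y => rfl⟩
  rw [Real.norm_eq_abs, abs_of_nonneg (Real.iSup_nonneg fun a => (h01 _).1)]
  exact Real.iSup_le (fun a => (h01 _).2) zero_le_one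

/-- Finitely many functions in `RUCB G` tell the points of `G` from their translates by `g ≠ 1`,
uniformly. -/
theorem exists_separating [LocallyCompactSpace G] [T2Space G] {g : G} (hg : g ≠ 1) :
    ∃ (n : ℕ) (f : ℕ → RUCB G), ∀ y, ∃ i < n, 1 ≤ (f i).1 y - (f i).1 (g * y) := by
  obtain ⟨A, B, hA, hB, hAB⟩ := t2_separation_nhds hg
  obtain ⟨U, hU, hUs, hUc⟩ := local_compact_nhds (x := (1 : G)) (n := B ∩ (g * ·) ⁻¹' A)
    (inter_mem hB ((continuous_const_mul g).continuousAt.preimage_mem_nhds (by simpa using hA)))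
  have hgU : IsCompact ((g * ·) '' U) := hUc.image (continuous_const_mul g)
  have hdisj : Disjoint U ((g * ·) '' U) := by
    rw [Set.disjoint_left]
    rintro x hx ⟨u, hu, rfl⟩
    exact Set.disjoint_left.1 hAB (hUs hu).2 (hUs hx).1
  obtain ⟨h, hone, hzero, hsupp, h01⟩ :=
    exists_continuous_one_zero_of_isCompact hUc hgU.isClosed hdisj
  have huc : ∀ ε > 0, ∀ᶠ v in 𝓝 (1 : G), ∀ x, |h (v * x) - h x| < ε := by
    refine uniformContinuous_right_iff.1 ?_
    let _ := IsTopologicalGroup.rightUniformSpace G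
    exact hsupp.uniformContinuous_of_continuous h.continuous
  -- With this `K`, if `g * y * a⁻¹ ∈ gU` and `h (g * y * b⁻¹) ≠ 0`, then `a * b⁻¹ ∈ K`, which
  -- forces `a = b`.
  obtain ⟨n, M, hM, hcov⟩ := exists_cover_discrete hU
    (K := ((g * ·) '' U)⁻¹ * tsupport h) (hgU.inv.mul hsupp)
  choose f hf using fun i => exists_iSup_translates h01 huc (M i)
  refine ⟨n, f, fun y => ?_⟩
  obtain ⟨i, hi, a, ha, hya⟩ := hcov y
  refine ⟨i, hi, ?_⟩
  have h1 : 1 ≤ (f i).1 y := by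
    rw [hf]
    refine le_trans (hone hya).ge (le_ciSup (f := fun a : M i => h (y * (a : G)⁻¹)) ?_ ⟨a, ha⟩)
    exact ⟨1, by rintro _ ⟨a, rfl⟩; exact (h01 _).2⟩
  have h2 : (f i).1 (g * y) ≤ 0 := by
    rw [hf]
    refine Real.iSup_le (fun b => le_of_eq ?_) le_rfl
    have hmem : g * (y * a⁻¹) ∈ (g * ·) '' U := ⟨_, hya, rfl⟩
    by_cases hab : a = b
    · rw [← hab, mul_assoc]
      exact hzero hmem
    · by_contra hne
      refine hM i ha b.2 hab ⟨(g * (y * a⁻¹))⁻¹, by simpa using hmem, g * y * (b : G)⁻¹,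
        subset_tsupport _ hne, ?_⟩
      simp [mul_assoc]
  linarith

end RUCB

namespace Sam

theorem map_nonneg (φ : Sam G) {a : RUCB G} (ha : 0 ≤ a) : 0 ≤ φ.1 a := by
  have h := φ.2.1 a 0
  rw [sup_eq_left.2 ha, map_zero] at h
  exact h ▸ le_sup_right

theorem map_mono (φ : Sam G) {a b : RUCB G} (hab : a ≤ b) : φ.1 a ≤ φ.1 b := by
  have h := φ.2.1 b a
  rw [sup_eq_left.2 hab] at h
  exact h ▸ le_sup_right

theorem map_le_norm (φ : Sam G) (a : RUCB G) : φ.1 a ≤ ‖a‖ := by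
  have h : φ.1 a ≤ φ.1 (‖a‖ • (1 : RUCB G)) := φ.map_mono fun x => by
    have := (le_abs_self _).trans (a.1.norm_coe_le_norm x)
    change a.1 x ≤ ‖a‖ * 1
    simpa using this
  rwa [map_smul, φ.2.2, smul_eq_mul, mul_one] at h

theorem abs_map_le_norm (φ : Sam G) (a : RUCB G) : |φ.1 a| ≤ ‖a‖ := by
  have h : φ.1 (-a) = -φ.1 a := map_neg φ.1 a
  exact abs_le'.2 ⟨φ.map_le_norm a, h ▸ (φ.map_le_norm (-a)).trans_eq (norm_neg a)⟩

theorem map_sub (φ : Sam G) (a b : RUCB G) : φ.1 (a - b) = φ.1 a - φ.1 b :=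
  _root_.map_sub φ.1 a b

theorem dist_map_le (φ : Sam G) (a b : RUCB G) : dist (φ.1 a) (φ.1 b) ≤ dist a b := by
  rw [Real.dist_eq, ← φ.map_sub]
  exact (φ.abs_map_le_norm (a - b)).trans_eq (dist_eq_norm a b).symm

theorem smul_apply (g : G) (φ : Sam G) (f : RUCB G) :
    (g • φ).1 f = φ.1 (RUCB.translate g f) := rfl

theorem continuous_eval (f : RUCB G) : Continuous fun φ : Sam G => φ.1 f :=
  (WeakDual.eval_continuous f).comp continuous_subtype_val

/-- The evaluation at the identity, as a point of the Samuel compactification. -/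
noncomputable def evalOne : Sam G :=
  ⟨((BoundedContinuousFunction.evalCLM ℝ (1 : G)).comp (RUCB G).subtypeL : RUCB G →L[ℝ] ℝ),
    fun _ _ => rfl, rfl⟩

instance : Nonempty (Sam G) := ⟨evalOne⟩

instance : T2Space (Sam G) :=
  inferInstanceAs (T2Space
    {φ : WeakDual ℝ (RUCB G) // (∀ a b : RUCB G, φ (a ⊔ b) = φ a ⊔ φ b) ∧ φ 1 = 1})

/-- Banach–Alaoglu: the defining equations are weak-* closed, and positivity with `φ 1 = 1` gives
norm at most `1`. -/
instance : CompactSpace (Sam G) := by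
  refine isCompact_iff_compactSpace.1 (?_ : IsCompact {φ : WeakDual ℝ (RUCB G) |
    (∀ a b : RUCB G, φ (a ⊔ b) = φ a ⊔ φ b) ∧ φ 1 = 1})
  refine (WeakDual.isCompact_closedBall (𝕜 := ℝ) (E := RUCB G) 0 1).of_isClosed_subset ?_ ?_
  · have he := fun f : RUCB G => WeakDual.eval_continuous (𝕜 := ℝ) f
    have hsup : IsClosed {φ : WeakDual ℝ (RUCB G) | ∀ a b : RUCB G, φ (a ⊔ b) = φ a ⊔ φ b} := by
      simp only [Set.ofPred_forall]
      exact isClosed_iInter fun a => isClosed_iInter fun b =>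
        isClosed_eq (he _) ((he a).sup (he b))
    exact hsup.inter (isClosed_eq (he 1) continuous_const)
  · intro φ hφ
    rw [Set.mem_preimage, mem_closedBall_zero_iff]
    refine ContinuousLinearMap.opNorm_le_bound _ zero_le_one fun a => ?_
    rw [one_mul]
    exact abs_map_le_norm ⟨φ, hφ⟩ a

/-- Joint continuity holds because all `φ` are `1`-Lipschitz, so moving `g` changes values uniformly
in `φ`. -/
instance : ContinuousSMul G (Sam G) where
  continuous_smul := by
    refine Continuous.subtype_mk (WeakBilin.continuous_of_continuous_eval _ fun f => ?_) _
    rw [continuous_iff_continuousAt]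
    rintro ⟨g, φ⟩
    have h1 : Tendsto (fun p : G × Sam G => dist (RUCB.translate p.1 f) (RUCB.translate g f))
        (𝓝 (g, φ)) (𝓝 0) := by
      have : Continuous fun p : G × Sam G => dist (RUCB.translate p.1 f) (RUCB.translate g f) :=
        ((RUCB.continuous_translate f).comp continuous_fst).dist continuous_const
      simpa using this.tendsto (g, φ)
    have h2 : Tendsto (fun p : G × Sam G =>
        p.2.1 (RUCB.translate p.1 f) - p.2.1 (RUCB.translate g f)) (𝓝 (g, φ)) (𝓝 0) :=
      squeeze_zero_norm (fun p => p.2.dist_map_le _ _) h1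
    have h3 : Tendsto (fun p : G × Sam G => p.2.1 (RUCB.translate g f)) (𝓝 (g, φ))
        (𝓝 (φ.1 (RUCB.translate g f))) :=
      ((continuous_eval _).comp continuous_snd).tendsto (g, φ)
    have h4 := h2.add h3
    rw [zero_add] at h4
    exact h4.congr fun p => sub_add_cancel _ _

theorem isFlow : IsFlow G (Sam G) := ⟨inferInstance, inferInstance, inferInstance⟩

theorem smul_ne [LocallyCompactSpace G] [T2Space G] {g : G} (hg : g ≠ 1) (φ : Sam G) :
    g • φ ≠ φ := by
  intro hφ
  obtain ⟨n, f, hf⟩ := RUCB.exists_separating hg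
  let d : ℕ → RUCB G := fun i => (f i - RUCB.translate g (f i)) ⊔ 0
  have hd : ∀ i, φ.1 (d i) = 0 := fun i => by
    have h : φ.1 (RUCB.translate g (f i)) = φ.1 (f i) := by
      rw [← smul_apply, hφ]
    rw [φ.2.1, φ.map_sub, h, sub_self, map_zero, sup_idem]
  have hd0 : ∀ i x, 0 ≤ (d i).1 x := fun i x => le_max_right _ _
  have hle : (1 : RUCB G) ≤ ∑ i ∈ Finset.range n, d i := fun y => by
    obtain ⟨i, hi, h⟩ := hf y
    have h1 : (1 : ℝ) ≤ (d i).1 y := h.trans (le_max_left _ _)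
    have h2 : (∑ i ∈ Finset.range n, d i).1 y = ∑ i ∈ Finset.range n, (d i).1 y := by
      simp
    change (1 : ℝ) ≤ (∑ i ∈ Finset.range n, d i).1 y
    rw [h2]
    exact h1.trans (Finset.single_le_sum (f := fun i => (d i).1 y) (fun i _ => hd0 i y)
      (Finset.mem_range.2 hi))
  have := φ.map_mono hle
  rw [φ.2.2, map_sum, Finset.sum_eq_zero fun i _ => hd i] at this
  exact absurd this (by norm_num)

/-- Veech's theorem: a locally compact group acts freely on its Samuel compactification. -/
theorem isFreeAction [LocallyCompactSpace G] [T2Space G] : IsFreeAction G (Sam G) := by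
  intro φ a b hab
  by_contra hne
  refine smul_ne (g := b⁻¹ * a) (fun h => hne ?_) φ ?_
  · exact (inv_mul_eq_one.1 h).symm
  · rw [mul_smul, inv_smul_eq_iff]
    exact hab

end Sam

end Samuel

theorem corollary5p7 (G : Type u) [Group G] [TopologicalSpace G] [IsTopologicalGroup G]
    [LocallyCompactSpace G] [T2Space G] :
    (∃ (X : Type u) (_ : TopologicalSpace X) (_ : MulAction G X),
      Nonempty X ∧ IsFlow G X ∧ IsFreeAction G X) ∧
    (Nonempty (Sam G) ∧ IsFlow G (Sam G) ∧ IsFreeAction G (Sam G)) :=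
  ⟨⟨Sam G, inferInstance, inferInstance, inferInstance, Sam.isFlow, Sam.isFreeAction⟩,
    inferInstance, Sam.isFlow, Sam.isFreeAction⟩
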